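/- **Setting.** Let $M$ be a connected, locally path-connected compact metric space. For continuous $f:M\to\mathbb R$ put $$d_f(p,q)=f(p)+f(q)-2\sup_{\gamma:p\to q}\ \min_{t\in[0,1]} f(\gamma(t)),$$ the supremum being over continuous paths from $p$ to $q$, and let $T_f$ be the quotient of $M$ by $p\sim q\iff d_f(p,q)=0$, with the metric $d_f$ and the function induced by $f$. It is an $\mathbb R$-tree (the tree of the superlevel sets of $f$) rooted at the point where $f$ is minimal. A point $\sigma$ is above $\tau$ if $d_f(\tau,\sigma)=f(\sigma)-f(\tau)$, and $h(\tau)$ denotes the distance from $\tau$ to the highest leaf above $\tau$. For real $\varepsilon,x$ let * $N^\varepsilon_f\in\{0,1,\dots,\infty\}$ be the number of leaves of the trimmed tree $T_f^\varepsilon=\{\tau\in T_f: h(\tau)\ge\varepsilon\}$, i.e. the number of points of $T_f^\varepsilon$ with no other point of $T_f^\varepsilon$ above them (this is the number of bars of length at least $\varepsilon$ of the $H_0$-barcode of the superlevel sets of $f$, with infinite bars capped at $\inf f$ and with bars of length exactly $\varepsilon$ counted as they appear in $T_f^\varepsilon$); * $N^{x,x+\varepsilon}_f=\#\{\tau\in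 T_f: f(\tau)=x,\ h(\tau)\ge\varepsilon\}$ (the number of these bars that contain $[x,x+\varepsilon]$). Let $(\Omega,\mathcal F,\mathbb P)$ be a probability space and let $X$ and $X_n$ ($n\in\mathbb N$) be real-valued, almost surely continuous stochastic processes on it, indexed by $M$, such that $$\delta_n:=\operatorname*{ess\,sup}_{\Omega}\ \sup_{p\in M}|X(p)-X_n(p)|\xrightarrow[n\to\infty]{}0 .$$ **(1)** Suppose that $\mathbb E[N_X^\varepsilon]<\infty$ for all $\varepsilon>0$ and that $\varepsilon\mapsto\mathbb E[N_X^\varepsilon]$ is continuous on $(0,\infty)$. Then for every $\varepsilon>0$, $N^\varepsilon_{X_n}\to N^\varepsilon_X$ in $L^1$, and for every $n$ with $2\delta_n\le\varepsilon$, $$\mathbb E\,|N^\varepsilon_X-N^\varepsilon_{X_n}|\le\omega_\varepsilon(2\delta_n),\qquad \omega_\varepsilon(\eta):=\mathbb E\big[N_X^{\varepsilon-\eta}-N_X^{\varepsilon+\eta}\big]\in[0,\infty].$$ **(2)** Let $x\in\mathbb R$. Suppose that $\mathbb E[N_X^{x,x+\varepsilon}]<\infty$ for all $\varepsilon>0$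 and that the function $(y,\eta)\mapsto\mathbb E[N_X^{y,y+\eta}]\in[0,\infty]$ is continuous at $(x,\varepsilon)$ for every $\varepsilon>0$. Then for every $\varepsilon>0$, $N^{x,x+\varepsilon}_{X_n}\to N^{x,x+\varepsilon}_X$ in $L^1$, and for every $n$ with $2\delta_n\le\varepsilon$, $$\mathbb E\,|N^{x,x+\varepsilon}_X-N^{x,x+\varepsilon}_{X_n}|\le\omega_{x,\varepsilon}(2\delta_n),\qquad \omega_{x,\varepsilon}(\eta):=\mathbb E\Big[N_X^{x+\frac{\eta}{2},\,x+\varepsilon-\frac{\eta}{2}}-N_X^{x-\frac{\eta}{2},\,x+\varepsilon+\frac{\eta}{2}}\Big]\in[0,\infty].$$ Here convergence in $L^1$ includes that the limit is integrable, that all the variables are measurable up to null sets and almost surely finite, and that those of the sequence are integrable for all large $n$. -/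

import Mathlib

open MeasureTheory Filter Topology
open scoped ENNReal

noncomputable section

namespace HZeroTree

/-- The level `sup_{γ : p ⇝ q} min_t f (γ t)` at which `p` and `q` get connected in the superlevel
sets of `f`. -/
def mergeLevel {M : Type*} [TopologicalSpace M] (f : C(M, ℝ)) (p q : M) : ℝ :=
  ⨆ γ : Path p q, ⨅ t : unitInterval, f (γ t)

/-- The pseudo-distance `d_f(p, q) = f(p) + f(q) - 2 sup_γ min_t f (γ t)`. -/
def treeDist {M : Type*} [TopologicalSpace M] (f : C(M, ℝ)) (p q : M) : ℝ :=
  f p + f q - 2 * mergeLevel f p q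

theorem path_bddBelow {M : Type*} [TopologicalSpace M] (f : C(M, ℝ)) {p q : M} (γ : Path p q) :
    BddBelow (Set.range fun t : unitInterval => f (γ t)) :=
  (isCompact_range (f.continuous.comp γ.continuous)).bddBelow

theorem iInf_path_le_left {M : Type*} [TopologicalSpace M] (f : C(M, ℝ)) {p q : M}
    (γ : Path p q) : ⨅ t : unitInterval, f (γ t) ≤ f p := by
  simpa using ciInf_le (path_bddBelow f γ) 0

theorem iInf_path_le_right {M : Type*} [TopologicalSpace M] (f : C(M, ℝ)) {p q : M}
    (γ : Path p q) : ⨅ t : unitInterval, f (γ t) ≤ f q := by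
  simpa using ciInf_le (path_bddBelow f γ) 1

theorem iInf_path_le_mergeLevel {M : Type*} [TopologicalSpace M] (f : C(M, ℝ)) {p q : M}
    (γ : Path p q) : ⨅ t : unitInterval, f (γ t) ≤ mergeLevel f p q :=
  le_ciSup (f := fun γ : Path p q => ⨅ t : unitInterval, f (γ t))
    ⟨f p, by rintro _ ⟨γ', rfl⟩; exact iInf_path_le_left f γ'⟩ γ

theorem nonempty_path {M : Type*} [TopologicalSpace M] [ConnectedSpace M]
    [LocallyPathConnectedSpace M] (p q : M) : Nonempty (Path p q) := by
  have : PathConnectedSpace M := pathConnectedSpace_iff_connectedSpace.2 inferInstance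
  exact PathConnectedSpace.joined p q

theorem mergeLevel_le_left {M : Type*} [TopologicalSpace M] [ConnectedSpace M]
    [LocallyPathConnectedSpace M] (f : C(M, ℝ)) (p q : M) : mergeLevel f p q ≤ f p :=
  have := nonempty_path p q
  ciSup_le fun γ => iInf_path_le_left f γ

theorem mergeLevel_le_right {M : Type*} [TopologicalSpace M] [ConnectedSpace M]
    [LocallyPathConnectedSpace M] (f : C(M, ℝ)) (p q : M) : mergeLevel f p q ≤ f q :=
  have := nonempty_path p q
  ciSup_le fun γ => iInf_path_le_right f γ

theorem mergeLevel_self {M : Type*} [TopologicalSpace M] [ConnectedSpace M]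
    [LocallyPathConnectedSpace M] (f : C(M, ℝ)) (p : M) : mergeLevel f p p = f p := by
  refine le_antisymm (mergeLevel_le_left f p p) ?_
  simpa using iInf_path_le_mergeLevel f (Path.refl p)

theorem mergeLevel_symm_le {M : Type*} [TopologicalSpace M] [ConnectedSpace M]
    [LocallyPathConnectedSpace M] (f : C(M, ℝ)) (p q : M) :
    mergeLevel f p q ≤ mergeLevel f q p := by
  have := nonempty_path p q
  refine ciSup_le fun γ => le_trans ?_ (iInf_path_le_mergeLevel f γ.symm)
  refine le_ciInf fun t => ?_
  exact ciInf_le (path_bddBelow f γ) (unitInterval.symm t)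

theorem mergeLevel_comm {M : Type*} [TopologicalSpace M] [ConnectedSpace M]
    [LocallyPathConnectedSpace M] (f : C(M, ℝ)) (p q : M) :
    mergeLevel f p q = mergeLevel f q p :=
  le_antisymm (mergeLevel_symm_le f p q) (mergeLevel_symm_le f q p)

theorem min_le_mergeLevel {M : Type*} [TopologicalSpace M] [ConnectedSpace M]
    [LocallyPathConnectedSpace M] (f : C(M, ℝ)) (p q r : M) :
    min (mergeLevel f p q) (mergeLevel f q r) ≤ mergeLevel f p r := by
  have := nonempty_path p q
  have := nonempty_path q r
  by_contra! h
  obtain ⟨h1, h2⟩ := lt_min_iff.1 h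
  obtain ⟨γ, hγ⟩ := exists_lt_of_lt_ciSup h1
  obtain ⟨η, hη⟩ := exists_lt_of_lt_ciSup h2
  have key : min (⨅ t : unitInterval, f (γ t)) (⨅ t : unitInterval, f (η t)) ≤
      ⨅ t : unitInterval, f (γ.trans η t) := by
    refine le_ciInf fun t => ?_
    have ht : γ.trans η t ∈ Set.range γ ∪ Set.range η := by
      rw [← Path.trans_range]; exact ⟨t, rfl⟩
    rcases ht with ⟨s, hs⟩ | ⟨s, hs⟩
    · rw [← hs]; exact (min_le_left _ _).trans (ciInf_le (path_bddBelow f γ) s)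
    · rw [← hs]; exact (min_le_right _ _).trans (ciInf_le (path_bddBelow f η) s)
  have := key.trans (iInf_path_le_mergeLevel f (γ.trans η))
  exact absurd (lt_min hγ hη) (not_lt.2 this)

theorem treeDist_self {M : Type*} [TopologicalSpace M] [ConnectedSpace M]
    [LocallyPathConnectedSpace M] (f : C(M, ℝ)) (p : M) : treeDist f p p = 0 := by
  rw [treeDist, mergeLevel_self]; ring

theorem treeDist_comm {M : Type*} [TopologicalSpace M] [ConnectedSpace M]
    [LocallyPathConnectedSpace M] (f : C(M, ℝ)) (p q : M) :
    treeDist f p q = treeDist f q p := by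
  rw [treeDist, treeDist, mergeLevel_comm]; ring

theorem treeDist_triangle {M : Type*} [TopologicalSpace M] [ConnectedSpace M]
    [LocallyPathConnectedSpace M] (f : C(M, ℝ)) (p q r : M) :
    treeDist f p r ≤ treeDist f p q + treeDist f q r := by
  have h1 := min_le_mergeLevel f p q r
  have h2 := mergeLevel_le_right f p q
  have h3 := mergeLevel_le_left f q r
  simp only [treeDist]
  rcases min_le_iff.1 h1 with h | h <;> linarith

theorem eq_of_treeDist_eq_zero {M : Type*} [TopologicalSpace M] [ConnectedSpace M]
    [LocallyPathConnectedSpace M] (f : C(M, ℝ)) (p q : M) (h : treeDist f p q = 0) :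
    f p = f q := by
  have h1 := mergeLevel_le_left f p q
  have h2 := mergeLevel_le_right f p q
  rw [treeDist] at h
  apply le_antisymm <;> linarith

/-- A copy of the space `M`, to be equipped with the pseudo-distance `d_f`. -/
def PreTree {M : Type*} [TopologicalSpace M] (_f : C(M, ℝ)) : Type _ := M

instance instPseudoMetricSpacePreTree {M : Type*} [TopologicalSpace M] [ConnectedSpace M]
    [LocallyPathConnectedSpace M] (f : C(M, ℝ)) : PseudoMetricSpace (PreTree f) where
  dist p q := treeDist (M := M) f p q
  dist_self := treeDist_self f
  dist_comm := treeDist_comm f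
  dist_triangle := treeDist_triangle f

/-- The tree `T_f`: the quotient of `M` by `p ∼ q ↔ d_f(p, q) = 0`, a metric space for `d_f`. -/
abbrev MergeTree {M : Type*} [TopologicalSpace M] [ConnectedSpace M]
    [LocallyPathConnectedSpace M] (f : C(M, ℝ)) : Type _ :=
  SeparationQuotient (PreTree f)

/-- The function induced by `f` on its tree `T_f`. -/
def MergeTree.level {M : Type*} [TopologicalSpace M] [ConnectedSpace M]
    [LocallyPathConnectedSpace M] (f : C(M, ℝ)) : MergeTree f → ℝ :=
  SeparationQuotient.lift (fun p : PreTree f => f (show M from p))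
    fun p q h => eq_of_treeDist_eq_zero f p q (Metric.inseparable_iff.1 h)

/-- `τ` lies below `σ` (on the geodesic from the root, where `f` is minimal, to `σ`). -/
def MergeTree.Below {M : Type*} [TopologicalSpace M] [ConnectedSpace M]
    [LocallyPathConnectedSpace M] (f : C(M, ℝ)) (τ σ : MergeTree f) : Prop :=
  dist τ σ = MergeTree.level f σ - MergeTree.level f τ

/-- `h(τ)`: the distance from `τ` to the highest leaf of `T_f` above `τ`, that is, the largest
distance from `τ` to a point above it. -/
def MergeTree.height {M : Type*} [TopologicalSpace M] [ConnectedSpace M]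
    [LocallyPathConnectedSpace M] (f : C(M, ℝ)) (τ : MergeTree f) : ℝ :=
  sSup {r : ℝ | ∃ σ : MergeTree f, MergeTree.Below f τ σ ∧ r = dist τ σ}

/-- The `ε`-trimmed tree `T_f^ε`. -/
def MergeTree.trim {M : Type*} [TopologicalSpace M] [ConnectedSpace M]
    [LocallyPathConnectedSpace M] (f : C(M, ℝ)) (ε : ℝ) : Set (MergeTree f) :=
  {τ | ε ≤ MergeTree.height f τ}

/-- The leaves of the rooted tree `T_f^ε`: its points with no other point of `T_f^ε` above them
(the root counts as a leaf exactly when it is the only point of `T_f^ε`). -/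
def MergeTree.trimLeaves {M : Type*} [TopologicalSpace M] [ConnectedSpace M]
    [LocallyPathConnectedSpace M] (f : C(M, ℝ)) (ε : ℝ) : Set (MergeTree f) :=
  {τ | τ ∈ MergeTree.trim f ε ∧ ∀ σ ∈ MergeTree.trim f ε, MergeTree.Below f τ σ → σ = τ}

open Classical in
/-- `N_f^ε`, the number of leaves of `T_f^ε`, for continuous `f` (and `0`, as a placeholder, for
discontinuous `f`). -/
def barCount {M : Type*} [TopologicalSpace M] [ConnectedSpace M]
    [LocallyPathConnectedSpace M] (ε : ℝ) (f : M → ℝ) : ℕ∞ :=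
  if hf : Continuous f then (MergeTree.trimLeaves ⟨f, hf⟩ ε).encard else 0

open Classical in
/-- `N_f^{x, x+ε}`, the number of points `τ` of `T_f` with `f(τ) = x` and `h(τ) ≥ ε`, for
continuous `f` (and `0`, as a placeholder, for discontinuous `f`). -/
def levelCount {M : Type*} [TopologicalSpace M] [ConnectedSpace M]
    [LocallyPathConnectedSpace M] (x ε : ℝ) (f : M → ℝ) : ℕ∞ :=
  if hf : Continuous f then
    {τ : MergeTree (⟨f, hf⟩ : C(M, ℝ)) | MergeTree.level ⟨f, hf⟩ τ = x ∧
      ε ≤ MergeTree.height ⟨f, hf⟩ τ}.encard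
  else 0

/-- The norm of `X - Y` in `L^∞(Ω, L^∞(M))`: the essential supremum over `Ω` of
`sup_M |X - Y|`. -/
def supDist {M Ω : Type*} [MeasurableSpace Ω] (P : Measure Ω) (X Y : M → Ω → ℝ) : ℝ≥0∞ :=
  essSup (fun ω => ⨆ p : M, ‖X p ω - Y p ω‖ₑ) P

/-- `E[N_X^ε]`, in `[0, ∞]`. -/
def meanBarCount {M Ω : Type*} [TopologicalSpace M] [ConnectedSpace M]
    [LocallyPathConnectedSpace M] [MeasurableSpace Ω] (P : Measure Ω) (X : M → Ω → ℝ) (ε : ℝ) :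
    ℝ≥0∞ :=
  ∫⁻ ω, ((barCount ε fun p => X p ω : ℕ∞) : ℝ≥0∞) ∂P

/-- `ω_ε(η) = E[N_X^{ε-η} - N_X^{ε+η}]`, in `[0, ∞]`. -/
def barModulus {M Ω : Type*} [TopologicalSpace M] [ConnectedSpace M]
    [LocallyPathConnectedSpace M] [MeasurableSpace Ω] (P : Measure Ω) (X : M → Ω → ℝ) (ε η : ℝ) :
    ℝ≥0∞ :=
  ∫⁻ ω, (((barCount (ε - η) fun p => X p ω : ℕ∞) : ℝ≥0∞) -
    ((barCount (ε + η) fun p => X p ω : ℕ∞) : ℝ≥0∞)) ∂P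

/-- `E[N_X^{x, x+ε}]`, in `[0, ∞]`. -/
def meanLevelCount {M Ω : Type*} [TopologicalSpace M] [ConnectedSpace M]
    [LocallyPathConnectedSpace M] [MeasurableSpace Ω] (P : Measure Ω) (X : M → Ω → ℝ) (x ε : ℝ) :
    ℝ≥0∞ :=
  ∫⁻ ω, ((levelCount x ε fun p => X p ω : ℕ∞) : ℝ≥0∞) ∂P

/-- `ω_{x,ε}(η) = E[N_X^{x+η/2, x+ε-η/2} - N_X^{x-η/2, x+ε+η/2}]`, in `[0, ∞]`: the window
`[x, x+ε]` is shortened, respectively lengthened, by `η`. -/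
def levelModulus {M Ω : Type*} [TopologicalSpace M] [ConnectedSpace M]
    [LocallyPathConnectedSpace M] [MeasurableSpace Ω] (P : Measure Ω) (X : M → Ω → ℝ)
    (x ε η : ℝ) : ℝ≥0∞ :=
  ∫⁻ ω, (((levelCount (x + η / 2) (ε - η) fun p => X p ω : ℕ∞) : ℝ≥0∞) -
    ((levelCount (x - η / 2) (ε + η) fun p => X p ω : ℕ∞) : ℝ≥0∞)) ∂P

/-- `F_n → F` in `L¹(Ω, P)`, for `[0, ∞]`-valued counts that are to be a.s. finite, with `F`
integrable and `F_n` integrable for all large `n`. -/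
def TendstoL1 {Ω : Type*} [MeasurableSpace Ω] (P : Measure Ω) (F : ℕ → Ω → ℕ∞) (G : Ω → ℕ∞) :
    Prop :=
  (∀ n, ∀ᵐ ω ∂P, F n ω ≠ ⊤) ∧ (∀ᵐ ω ∂P, G ω ≠ ⊤) ∧
  (∀ n, AEStronglyMeasurable (fun ω => ((F n ω).toNat : ℝ)) P) ∧
  Integrable (fun ω => ((G ω).toNat : ℝ)) P ∧
  (∀ᶠ n in atTop, Integrable (fun ω => ((F n ω).toNat : ℝ)) P) ∧
  Tendsto (fun n => eLpNorm (fun ω => ((F n ω).toNat : ℝ) - ((G ω).toNat : ℝ)) 1 P)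
    atTop (𝓝 0)

end HZeroTree

end

namespace HZeroTree

/-! Counting in the tree is replaced by counting points of `M`. The trimmed tree has at least `k`
leaves iff there are `k` points, each at least `ε` above the minimum, such that each pair merges
more than `ε` below both of its points; likewise, at least `k` bars contain `[x, x+ε]` iff `k`
points above `x+ε` merge pairwise below `x` (`le_barCount_iff`, `le_levelCount_iff`).

A uniform perturbation of size `δ` moves values and merge levels by at most `δ`, so the same points
remain witnesses once `ε` is decreased by `2δ` (and, for windows, both ends are moved inwards by
`δ`). Hence `N_X^ε` and `N_{X_n}^ε` both lie between `N_X^{ε+2δ}` and `N_X^{ε-2δ}`, which gives the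
bound by the modulus. Since the mean of `N_X` is finite and continuous, the modulus tends to `0`.

Finiteness of the counts is a pigeonhole argument on a finite cover. Measurability comes from the
same characterizations: a closed condition and finitely many strict inequalities, in compactly many
unknowns, depending continuously on the function. -/

theorem natCast_le_encard_iff {α : Type*} {s : Set α} {k : ℕ} :
    (k : ℕ∞) ≤ s.encard ↔ ∃ z : Fin k → α, Function.Injective z ∧ ∀ i, z i ∈ s := by
  constructor
  · intro h
    obtain ⟨t, hts, ht⟩ := Set.exists_subset_encard_eq h
    have := (Set.finite_of_encard_eq_coe ht).fintype
    have hc : Fintype.card t = k := by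
      rw [Set.encard_eq_coe_toFinset_card, Set.toFinset_card] at ht
      exact_mod_cast ht
    let e := Fintype.equivFinOfCardEq hc
    exact ⟨fun i => e.symm i, Subtype.val_injective.comp e.symm.injective,
      fun i => hts (e.symm i).2⟩
  · rintro ⟨z, hz, hzs⟩
    have := Set.encard_le_encard (Set.range_subset_iff.2 hzs)
    refine le_trans ?_ this
    simpa using hz.encard_range

/-! ### Merge levels, ancestors, and leaves of the trimmed tree. -/

section Tree

variable {M : Type*} [TopologicalSpace M]

theorem le_mergeLevel_of_path {f : C(M, ℝ)} {p q : M} {c : ℝ} (γ : Path p q)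
    (h : ∀ t, c ≤ f (γ t)) : c ≤ mergeLevel f p q :=
  (le_ciInf h).trans (iInf_path_le_mergeLevel f γ)

theorem le_mergeLevel_of_isPathConnected {f : C(M, ℝ)} {U : Set M} (hU : IsPathConnected U)
    {c : ℝ} (hc : ∀ p ∈ U, c ≤ f p) {p q : M} (hp : p ∈ U) (hq : q ∈ U) :
    c ≤ mergeLevel f p q :=
  have h := hU.joinedIn p hp q hq
  le_mergeLevel_of_path h.somePath fun t => hc _ (h.somePath_mem t)

variable [ConnectedSpace M] [LocallyPathConnectedSpace M]

/-- The ultrametric inequality as transitivity of merging at level at least `c`; the order and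
equality arguments in the tree are chains of such inequalities. -/
theorem le_mergeLevel_trans {f : C(M, ℝ)} {p q r : M} {c : ℝ} (h₁ : c ≤ mergeLevel f p q)
    (h₂ : c ≤ mergeLevel f q r) : c ≤ mergeLevel f p r :=
  (le_min h₁ h₂).trans (min_le_mergeLevel f p q r)

/-- The merge levels of uniformly close functions are close. -/
theorem mergeLevel_le_add {f g : C(M, ℝ)} {δ : ℝ} (h : ∀ p, f p ≤ g p + δ) (p q : M) :
    mergeLevel f p q ≤ mergeLevel g p q + δ := by
  have := nonempty_path p q
  refine ciSup_le fun γ => ?_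
  rw [← sub_le_iff_le_add]
  refine le_mergeLevel_of_path γ fun t => ?_
  have := ciInf_le (path_bddBelow f γ) t
  linarith [h (γ t)]

/-- Below every point there is a point at each level between the minimum and its own level. -/
theorem exists_ancestor (f : C(M, ℝ)) {p r : M} {y : ℝ} (hr : f r ≤ y) (hy : y ≤ f p) :
    ∃ a, f a = y ∧ y ≤ mergeLevel f p a := by
  obtain ⟨γ⟩ := nonempty_path p r
  have hc : Continuous fun t => f (γ t) := f.continuous.comp γ.continuous
  -- The ancestor is the point where a path from `p` to `r` first reaches the sublevel set `f ≤ y`: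
  -- before time `t` the path stays above `y`, so its value at `t` is exactly `y`.
  obtain ⟨t, ht, hmin⟩ := (isClosed_le hc continuous_const).isCompact.exists_isMinOn
    (s := {t | f (γ t) ≤ y}) ⟨1, by simpa using hr⟩ continuousOn_id
  have hlt : ∀ s < t, y < f (γ s) := fun s hs => by
    by_contra! h
    exact absurd (hmin h) (not_le.2 hs)
  have hle : y ≤ f (γ t) := by
    rcases eq_or_lt_of_le (zero_le : (0 : unitInterval) ≤ t) with h | h
    · rw [← h]; simpa using hy
    · have hcl : t ∈ closure (Set.Iio t) := by
        rw [closure_Iio' (a := t) ⟨0, h⟩]; exact Set.mem_Iic.2 le_rfl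
      exact closure_minimal (fun s hs => (hlt s hs).le) (isClosed_le continuous_const hc) hcl
  let η : Path p (γ t) :=
    { toFun := fun s => γ (s * t)
      continuous_toFun := γ.continuous.comp (continuous_id.mul continuous_const)
      source' := by simp
      target' := by simp }
  refine ⟨γ t, le_antisymm ht hle, le_mergeLevel_of_path η fun s => ?_⟩
  change y ≤ f (γ (s * t))
  have hst : s * t ≤ t := unitInterval.mul_le_right
  rcases eq_or_lt_of_le hst with h | h
  · rw [h]; exact hle
  · exact (hlt _ h).le

/-- The projection of `M` to the tree is continuous. -/
theorem continuous_toPreTree (f : C(M, ℝ)) : Continuous fun p : M => (show PreTree f from p) := by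
  rw [continuous_iff_continuousAt]
  intro p
  refine Metric.tendsto_nhds.2 fun ε hε => ?_
  -- With oscillation `ε/4`, the distance is below `(f p + ε/4) + f p - 2(f p - ε/4) = 3ε/4`.
  have hU : {q | |f q - f p| < ε / 4} ∈ 𝓝 p :=
    (isOpen_lt ((f.continuous.sub continuous_const).abs) continuous_const).mem_nhds (by
      simpa using by positivity)
  obtain ⟨V, ⟨hV, hVc⟩, hVU⟩ := (path_connected_basis p).mem_iff.1 hU
  filter_upwards [hV] with q hq
  have h1 : f p - ε / 4 ≤ mergeLevel f q p := by
    refine le_mergeLevel_of_isPathConnected hVc (fun r hr => ?_) hq (mem_of_mem_nhds hV)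
    have h0 : |f r - f p| < ε / 4 := hVU hr
    have := (abs_lt.1 h0).1
    linarith
  have h0 : |f q - f p| < ε / 4 := hVU hq
  have h2 := (abs_lt.1 h0).2
  change treeDist f q p < ε
  rw [treeDist]
  linarith

theorem continuous_mergeLevel (f : C(M, ℝ)) :
    Continuous fun z : M × M => mergeLevel f z.1 z.2 := by
  have h : Continuous fun z : M × M => treeDist f z.1 z.2 :=
    continuous_dist.comp (((continuous_toPreTree f).comp continuous_fst).prodMk
      ((continuous_toPreTree f).comp continuous_snd))
  have h2 : (fun z : M × M => mergeLevel f z.1 z.2) =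
      fun z => (f z.1 + f z.2 - treeDist f z.1 z.2) / 2 := by
    ext z; simp only [treeDist]; ring
  rw [h2]
  fun_prop

namespace MergeTree

/-- The point of the tree `T_f` given by a point of `M`. -/
noncomputable def mk (f : C(M, ℝ)) (p : M) : MergeTree f :=
  SeparationQuotient.mk (X := PreTree f) p

theorem surjective_mk (f : C(M, ℝ)) : Function.Surjective (mk f) :=
  SeparationQuotient.surjective_mk (X := PreTree f)

@[simp]
theorem level_mk (f : C(M, ℝ)) (p : M) : level f (mk f p) = f p := rfl

theorem dist_mk (f : C(M, ℝ)) (p q : M) : dist (mk f p) (mk f q) = treeDist f p q :=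
  SeparationQuotient.dist_mk (α := PreTree f) p q

theorem below_mk {f : C(M, ℝ)} {p q : M} :
    Below f (mk f p) (mk f q) ↔ f p ≤ mergeLevel f p q := by
  rw [Below, dist_mk, level_mk, level_mk, treeDist]
  have := mergeLevel_le_left f p q
  constructor <;> intro h <;> linarith

theorem mk_eq_mk {f : C(M, ℝ)} {p q : M} :
    mk f p = mk f q ↔ f p ≤ mergeLevel f p q ∧ f q ≤ mergeLevel f p q := by
  rw [← dist_eq_zero, dist_mk, treeDist]
  have h1 := mergeLevel_le_left f p q
  have h2 := mergeLevel_le_right f p q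
  constructor
  · intro h; constructor <;> linarith
  · intro h; linarith

variable [CompactSpace M]

/-- The height of a point of the tree is attained at a highest point above it. -/
theorem exists_top (f : C(M, ℝ)) (p : M) :
    ∃ q, f p ≤ mergeLevel f p q ∧ height f (mk f p) = f q - f p ∧
      ∀ r, f p ≤ mergeLevel f p r → f r ≤ f q := by
  -- The points above `p` form a closed, hence compact, set containing `p`, so `f` has a maximum on
  -- it.
  have hcl : IsClosed {q | f p ≤ mergeLevel f p q} :=
    isClosed_le continuous_const
      ((continuous_mergeLevel f).comp (continuous_const.prodMk continuous_id))
  obtain ⟨q, hq, hmax⟩ := hcl.isCompact.exists_isMaxOn ⟨p, (mergeLevel_self f p).ge⟩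
    f.continuous.continuousOn
  refine ⟨q, hq, ?_, fun r hr => hmax hr⟩
  refine IsGreatest.csSup_eq ⟨⟨mk f q, below_mk.2 hq, (below_mk.2 hq).symm⟩, ?_⟩
  rintro _ ⟨σ, hσ, rfl⟩
  obtain ⟨s, rfl⟩ := surjective_mk f σ
  rw [hσ, level_mk, level_mk]
  exact sub_le_sub_right (hmax (below_mk.1 hσ)) _

theorem sub_le_height {f : C(M, ℝ)} {p q : M} (h : f p ≤ mergeLevel f p q) :
    f q - f p ≤ height f (mk f p) := by
  obtain ⟨t, -, ht, hmax⟩ := exists_top f p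
  rw [ht]
  exact sub_le_sub_right (hmax q h) _

/-- A leaf of the `ε`-trimmed tree lies `ε` below a highest point above it. -/
theorem exists_top_of_mem_trimLeaves {f : C(M, ℝ)} {ε : ℝ} (hε : 0 ≤ ε) {p : M}
    (hp : mk f p ∈ trimLeaves f ε) : ∃ q, f p ≤ mergeLevel f p q ∧ f q = f p + ε := by
  obtain ⟨q, hq, hh, -⟩ := exists_top f p
  have h1 : ε ≤ f q - f p := hh ▸ hp.1
  refine ⟨q, hq, ?_⟩
  -- The point `ε` below the top `q` is still in the trimmed tree and lies above `p`; as `p` is a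
  -- leaf, the two coincide.
  obtain ⟨a, ha, hqa⟩ := exists_ancestor f (p := q) (r := p) (y := f q - ε) (by linarith)
    (by linarith)
  have hpa : f p ≤ mergeLevel f p a := le_mergeLevel_trans hq (le_trans (by linarith) hqa)
  have hat : mk f a ∈ trim f ε := by
    have := sub_le_height (f := f) (p := a) (q := q) (by rw [ha, mergeLevel_comm]; exact hqa)
    change ε ≤ _
    linarith
  have := eq_of_treeDist_eq_zero f a p (by
    rw [← dist_mk, dist_eq_zero]; exact hp.2 _ hat (below_mk.2 hpa))
  linarith

/-- Above every point of the `ε`-trimmed tree there is a leaf. -/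
theorem exists_mem_trimLeaves {f : C(M, ℝ)} {ε : ℝ} (hε : 0 ≤ ε) {a : M}
    (ha : mk f a ∈ trim f ε) : ∃ l, mk f l ∈ trimLeaves f ε ∧ f a ≤ mergeLevel f a l := by
  obtain ⟨b, hb, hh, hmax⟩ := exists_top f a
  have h1 : ε ≤ f b - f a := hh ▸ ha
  -- The leaf is the point `ε` below the highest point `b` above `a`. A point of the trimmed tree
  -- above `l` has its top no higher than `b`, so it cannot exceed the level of `l`.
  obtain ⟨l, hl, hbl⟩ := exists_ancestor f (p := b) (r := a) (y := f b - ε) (by linarith)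
    (by linarith)
  have hal : f a ≤ mergeLevel f a l := le_mergeLevel_trans hb (le_trans (by linarith) hbl)
  refine ⟨l, ⟨?_, fun σ hσ hlσ => ?_⟩, hal⟩
  · have := sub_le_height (f := f) (p := l) (q := b) (by rw [hl, mergeLevel_comm]; exact hbl)
    change ε ≤ _
    linarith
  · obtain ⟨s, rfl⟩ := surjective_mk f σ
    rw [below_mk] at hlσ
    obtain ⟨t, ht, hht, -⟩ := exists_top f s
    have h2 : ε ≤ f t - f s := hht ▸ hσ
    have hls := hlσ.trans (mergeLevel_le_right f l s)
    have hla : f a ≤ f l := by linarith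
    have := hmax t (le_mergeLevel_trans (le_mergeLevel_trans hal (hla.trans hlσ))
      ((hla.trans hls).trans ht))
    rw [eq_comm, mk_eq_mk]
    exact ⟨hlσ, by linarith⟩

theorem mem_trim_of_ancestor {f : C(M, ℝ)} {ε : ℝ} {p a : M} (ha : f a + ε ≤ f p)
    (hpa : f a ≤ mergeLevel f p a) : mk f a ∈ trim f ε := by
  have := sub_le_height (f := f) (p := a) (q := p) (by rwa [mergeLevel_comm])
  change ε ≤ _
  linarith

end MergeTree

/-! ### Counting bars by points of `M`; stability and finiteness. -/

variable [CompactSpace M]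

open MergeTree

/-- The `ε`-trimmed tree has at least `k` leaves iff there are `k` points of `M` at height at
least `ε` that pairwise merge more than `ε` below them. -/
theorem le_barCount_iff (f : C(M, ℝ)) {ε : ℝ} (hε : 0 ≤ ε) (k : ℕ) :
    (k : ℕ∞) ≤ barCount ε f ↔ ∃ (r : M) (z : Fin k → M), (∀ i, f r ≤ f (z i) - ε) ∧
      ∀ i j, i ≠ j → mergeLevel f (z i) (z j) < f (z i) - ε := by
  have hb : barCount ε f = (trimLeaves f ε).encard := dif_pos f.continuous
  rw [hb, natCast_le_encard_iff]
  constructor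
  · rintro ⟨τ, hτ, hl⟩
    choose p hp using fun i => surjective_mk f (τ i)
    have hl' : ∀ i, mk f (p i) ∈ trimLeaves f ε := fun i => (hp i).symm ▸ hl i
    choose q hq hfq using fun i => exists_top_of_mem_trimLeaves hε (hl' i)
    obtain ⟨r, -, hr⟩ := isCompact_univ.exists_isMinOn (Set.univ_nonempty (α := M))
      f.continuous.continuousOn
    refine ⟨r, q, fun i => ?_, fun i j hij => ?_⟩
    · have : f r ≤ f (p i) := hr (Set.mem_univ _)
      linarith [hfq i]
    · by_contra! h
      have h1 : f (p i) ≤ mergeLevel f (p i) (q j) :=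
        le_mergeLevel_trans (hq i) (by linarith [hfq i])
      have h2 := hq j
      rw [mergeLevel_comm] at h2
      -- If the tops merged at the level of `p i` or higher, the lower of the two leaves would lie
      -- below the other, which the leaf property forbids.
      rcases le_total (f (p i)) (f (p j)) with h3 | h3
      · have := (hl' i).2 _ (hl' j).1 (below_mk.2 (le_mergeLevel_trans h1 (h3.trans h2)))
        rw [hp, hp] at this
        exact hij (hτ this.symm)
      · have := (hl' j).2 _ (hl' i).1 (below_mk.2 (by
          rw [mergeLevel_comm]; exact le_mergeLevel_trans (h3.trans h1) h2))
        rw [hp, hp] at this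
        exact hij (hτ this)
  · rintro ⟨r, z, hr, hz⟩
    -- Descend by `ε` from each `z i`, then climb to a leaf. The point `r` guarantees that the level
    -- `f (z i) - ε` is reached; this matters for `k = 1`, where the pairwise condition is void.
    choose a ha hza using fun i => exists_ancestor f (hr i) (sub_le_self _ hε)
    have hat : ∀ i, mk f (a i) ∈ trim f ε := fun i =>
      mem_trim_of_ancestor (p := z i) (by linarith [ha i]) (by rw [ha]; exact hza i)
    choose l hl hal using fun i => exists_mem_trimLeaves hε (hat i)
    have hzl : ∀ i, f (z i) - ε ≤ mergeLevel f (z i) (l i) := fun i =>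
      le_mergeLevel_trans (hza i) (by rw [← ha]; exact hal i)
    refine ⟨fun i => mk f (l i), fun i j hij => ?_, hl⟩
    by_contra hne
    have h1 := (mk_eq_mk.1 hij).1
    have h2 : ∀ i, f (z i) - ε ≤ f (l i) := fun i => (hzl i).trans (mergeLevel_le_right _ _ _)
    -- A common leaf would join `z i` to `z j` above the lower of the two levels `f (z i) - ε` and
    -- `f (z j) - ε`.
    have h3 : min (f (z i) - ε) (f (z j) - ε) ≤ mergeLevel f (z i) (z j) := by
      refine le_mergeLevel_trans (q := l i) ((min_le_left _ _).trans (hzl i)) ?_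
      refine le_mergeLevel_trans (q := l j) ((min_le_left _ _).trans ((h2 i).trans h1)) ?_
      rw [mergeLevel_comm]
      exact (min_le_right _ _).trans (hzl j)
    have h4 := hz j i (Ne.symm hne)
    rw [mergeLevel_comm] at h4
    exact absurd (lt_min (hz i j hne) h4) (not_lt.2 h3)

/-- At least `k` bars contain `[x, x + ε]` iff there are `k` points of `M` above the level
`x + ε` that pairwise merge below the level `x`. -/
theorem le_levelCount_iff (f : C(M, ℝ)) (x : ℝ) {ε : ℝ} (hε : 0 ≤ ε) (k : ℕ) :
    (k : ℕ∞) ≤ levelCount x ε f ↔ ∃ (r : M) (z : Fin k → M),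
      (∀ i, f r ≤ x ∧ x + ε ≤ f (z i)) ∧ ∀ i j, i ≠ j → mergeLevel f (z i) (z j) < x := by
  have hb : levelCount x ε f = {τ : MergeTree f | level f τ = x ∧ ε ≤ height f τ}.encard :=
    dif_pos f.continuous
  rw [hb, natCast_le_encard_iff]
  constructor
  · rintro ⟨τ, hτ, hl⟩
    choose p hp using fun i => surjective_mk f (τ i)
    have hx : ∀ i, f (p i) = x := fun i => by rw [← (hl i).1, ← hp i]; rfl
    choose q hq hfq using fun i => exists_top f (p i)
    obtain ⟨r, -, hr⟩ := isCompact_univ.exists_isMinOn (Set.univ_nonempty (α := M))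
      f.continuous.continuousOn
    refine ⟨r, q, fun i => ⟨?_, ?_⟩, fun i j hij => ?_⟩
    · rw [← hx i]; exact hr (Set.mem_univ _)
    · have := (hl i).2
      rw [← hp i, (hfq i).1, hx] at this
      linarith
    · by_contra! h
      have h1 := hq i
      have h2 := hq j
      rw [mergeLevel_comm] at h2
      rw [hx] at h1 h2
      have h3 := le_mergeLevel_trans (le_mergeLevel_trans h1 h) h2
      refine hij (hτ ?_)
      rw [← hp i, ← hp j, mk_eq_mk, hx, hx]
      exact ⟨h3, h3⟩
  · rintro ⟨r, z, hr, hz⟩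
    choose a ha hza using fun i => exists_ancestor f (p := z i) (hr i).1
      (by linarith [(hr i).2] : x ≤ f (z i))
    refine ⟨fun i => mk f (a i), fun i j hij => ?_, fun i => ⟨ha i, ?_⟩⟩
    · by_contra hne
      have h1 := (mk_eq_mk.1 hij).1
      rw [ha] at h1
      have h2 := hza j
      rw [mergeLevel_comm] at h2
      exact absurd (hz i j hne) (not_lt.2 (le_mergeLevel_trans (le_mergeLevel_trans (hza i) h1) h2))
    · exact mem_trim_of_ancestor (p := z i) (by linarith [ha i, (hr i).2])
        (by rw [ha]; exact hza i)

/-- Stability of the number of bars under uniform perturbations. -/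
theorem barCount_add_le {f g : C(M, ℝ)} {δ : ℝ} (hfg : ∀ p, |f p - g p| ≤ δ) {ε : ℝ}
    (hε : 0 ≤ ε) : barCount (ε + 2 * δ) f ≤ barCount ε g := by
  have h1 : ∀ p, f p ≤ g p + δ := fun p => by linarith [(abs_le.1 (hfg p)).2]
  have h2 : ∀ p, g p ≤ f p + δ := fun p => by linarith [(abs_le.1 (hfg p)).1]
  -- Testing against every finite `k` also covers infinite counts. The same `r` and `z` serve for
  -- `g`: each inequality compares two quantities that each move by at most `δ`.
  refine ENat.forall_natCast_le_iff_le.1 fun k => ?_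
  have hδ : 0 ≤ δ := (abs_nonneg _).trans (hfg (Classical.arbitrary M))
  rw [le_barCount_iff f (by positivity), le_barCount_iff g hε]
  rintro ⟨r, z, hr, hz⟩
  refine ⟨r, z, fun i => ?_, fun i j hij => ?_⟩
  · linarith [hr i, h1 (z i), h2 r]
  · linarith [hz i j hij, h1 (z i), mergeLevel_le_add h2 (z i) (z j)]

/-- Stability of the number of bars containing an interval under uniform perturbations. -/
theorem levelCount_add_le {f g : C(M, ℝ)} {δ : ℝ} (hfg : ∀ p, |f p - g p| ≤ δ) (x : ℝ) {ε : ℝ}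
    (hε : 0 ≤ ε) : levelCount (x - δ) (ε + 2 * δ) f ≤ levelCount x ε g := by
  have h1 : ∀ p, f p ≤ g p + δ := fun p => by linarith [(abs_le.1 (hfg p)).2]
  have h2 : ∀ p, g p ≤ f p + δ := fun p => by linarith [(abs_le.1 (hfg p)).1]
  refine ENat.forall_natCast_le_iff_le.1 fun k => ?_
  have hδ : 0 ≤ δ := (abs_nonneg _).trans (hfg (Classical.arbitrary M))
  rw [le_levelCount_iff f _ (by positivity), le_levelCount_iff g _ hε]
  rintro ⟨r, z, hr, hz⟩
  refine ⟨r, z, fun i => ⟨?_, ?_⟩, fun i j hij => ?_⟩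
  · linarith [(hr i).1, h2 r]
  · linarith [(hr i).2, h1 (z i)]
  · linarith [hz i j hij, mergeLevel_le_add h2 (z i) (z j)]

omit [ConnectedSpace M] in
/-- A compact space is covered by finitely many sets on which `f` oscillates by less than `ε`
and whose points merge less than `ε` below them. -/
theorem exists_finite_cover_mergeLevel (f : C(M, ℝ)) {ε : ℝ} (hε : 0 < ε) :
    ∃ (K : ℕ) (c : M → Fin K), ∀ p q, c p = c q → f p - ε ≤ mergeLevel f p q := by
  have hU : ∀ p, {q | |f q - f p| < ε / 2} ∈ 𝓝 p := fun p =>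
    (isOpen_lt ((f.continuous.sub continuous_const).abs) continuous_const).mem_nhds (by
      simpa using by positivity)
  choose V hV hVU using fun p => (path_connected_basis p).mem_iff.1 (hU p)
  obtain ⟨t, ht⟩ := CompactSpace.elim_nhds_subcover V fun p => (hV p).1
  have hmem : ∀ p, ∃ x : t, p ∈ V x := fun p => by
    have : p ∈ ⋃ x ∈ t, V x := ht ▸ Set.mem_univ p
    simpa using this
  choose c hc using hmem
  refine ⟨Fintype.card t, fun p => Fintype.equivFin t (c p), fun p q hpq => ?_⟩
  have hpq := (Fintype.equivFin t).injective hpq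
  have hq := hc q
  rw [← hpq] at hq
  refine le_mergeLevel_of_isPathConnected (hV (c p)).2 (fun s hs => ?_) (hc p) hq
  have h1 : |f p - f (c p)| < ε / 2 := hVU _ (hc p)
  have h2 : |f s - f (c p)| < ε / 2 := hVU _ hs
  rw [abs_lt] at h1 h2
  linarith [h1.2, h2.1]

/-- Pigeonhole: among `K + 1` witnesses two lie in the same piece of the cover, and so merge within
`ε`. -/
theorem barCount_ne_top (f : C(M, ℝ)) {ε : ℝ} (hε : 0 < ε) : barCount ε f ≠ ⊤ := by
  obtain ⟨K, c, hc⟩ := exists_finite_cover_mergeLevel f hε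
  intro h
  have h1 : ((K + 1 : ℕ) : ℕ∞) ≤ barCount ε f := h ▸ le_top
  obtain ⟨r, z, -, hz⟩ := (le_barCount_iff f hε.le _).1 h1
  obtain ⟨i, j, hij, he⟩ := Fintype.exists_ne_map_eq_of_card_lt (fun i => c (z i)) (by simp)
  exact absurd (hz i j hij) (not_lt.2 (hc _ _ he))

theorem levelCount_ne_top (f : C(M, ℝ)) (x : ℝ) {ε : ℝ} (hε : 0 < ε) :
    levelCount x ε f ≠ ⊤ := by
  obtain ⟨K, c, hc⟩ := exists_finite_cover_mergeLevel f hε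
  intro h
  have h1 : ((K + 1 : ℕ) : ℕ∞) ≤ levelCount x ε f := h ▸ le_top
  obtain ⟨r, z, hr, hz⟩ := (le_levelCount_iff f x hε.le _).1 h1
  obtain ⟨i, j, hij, he⟩ := Fintype.exists_ne_map_eq_of_card_lt (fun i => c (z i)) (by simp)
  linarith [hz i j hij, hc _ _ he, (hr i).2]

end Tree

/-! ### Measurability of the counts. -/

section Measurability

variable {M : Type*} [MetricSpace M] [CompactSpace M] {Ω : Type*} [MeasurableSpace Ω]

/-- A family of continuous functions whose evaluations are measurable is Borel measurable for the
uniform topology. -/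
theorem measurableSet_preimage_of_isOpen [Nonempty M] {F : Ω → C(M, ℝ)}
    (hF : ∀ p, Measurable fun ω => F ω p) {U : Set C(M, ℝ)} (hU : IsOpen U) :
    MeasurableSet (F ⁻¹' U) := by
  have hball : ∀ (g : C(M, ℝ)) (r : ℝ), 0 ≤ r →
      MeasurableSet (F ⁻¹' Metric.closedBall g r) := by
    intro g r hr
    -- By continuity, the uniform distance is decided on a countable dense set.
    have : F ⁻¹' Metric.closedBall g r =
        ⋂ n, {ω | dist (F ω (TopologicalSpace.denseSeq M n))
          (g (TopologicalSpace.denseSeq M n)) ≤ r} := by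
      ext ω
      simp only [Set.mem_preimage, Metric.mem_closedBall, Set.mem_iInter, Set.mem_ofPred_eq]
      rw [ContinuousMap.dist_le hr]
      refine ⟨fun h n => h _, fun h p => ?_⟩
      exact isClosed_property (TopologicalSpace.denseRange_denseSeq M)
        (isClosed_le ((F ω).continuous.dist g.continuous) continuous_const) h p
    rw [this]
    exact MeasurableSet.iInter fun n => measurableSet_le ((hF _).dist measurable_const)
      measurable_const
  have hr : ∀ g : U, ∃ r, 0 < r ∧ Metric.closedBall (g : C(M, ℝ)) r ⊆ U := fun g =>
    Metric.nhds_basis_closedBall.mem_iff.1 (hU.mem_nhds g.2)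
  choose r hr0 hrU using hr
  obtain ⟨t, ht, hteq⟩ := TopologicalSpace.isOpen_iUnion_countable
    (fun g : U => Metric.ball (g : C(M, ℝ)) (r g)) fun _ => Metric.isOpen_ball
  have hUeq : U = ⋃ g ∈ t, Metric.closedBall (g : C(M, ℝ)) (r g) := by
    refine Set.Subset.antisymm (fun g hg => ?_) (Set.iUnion₂_subset fun g _ => hrU g)
    have : g ∈ ⋃ g : U, Metric.ball (g : C(M, ℝ)) (r g) :=
      Set.mem_iUnion.2 ⟨⟨g, hg⟩, Metric.mem_ball_self (hr0 _)⟩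
    rw [← hteq] at this
    exact Set.iUnion₂_mono (fun g _ => Metric.ball_subset_closedBall) this
  rw [hUeq, Set.preimage_iUnion₂]
  exact MeasurableSet.biUnion ht fun g _ => hball _ _ (hr0 g).le

/-- Solvability, in a compact space of unknowns, of a closed condition and finitely many strict
inequalities depending continuously on a measurable random function is measurable. -/
theorem measurableSet_exists_mem_and_pos [Nonempty M] {F : Ω → C(M, ℝ)}
    (hF : ∀ p, Measurable fun ω => F ω p) {K ι : Type*} [TopologicalSpace K] [CompactSpace K]
    [Finite ι] {A : Set (C(M, ℝ) × K)} (hA : IsClosed A) {φ : ι → C(M, ℝ) × K → ℝ}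
    (hφ : ∀ i, Continuous (φ i)) :
    MeasurableSet {ω | ∃ y, (F ω, y) ∈ A ∧ ∀ i, 0 < φ i (F ω, y)} := by
  -- Projection along a compact factor is closed. Replacing `0 <` by `1/(n+1) ≤` makes the
  -- conditions closed, and finiteness of `ι` allows one `n` for all of them.
  have hcl : ∀ n : ℕ, IsClosed (Prod.fst '' (A ∩ ⋂ i, {z | 1 / ((n : ℝ) + 1) ≤ φ i z})) :=
    fun n => isClosedMap_fst_of_compactSpace _
      (hA.inter (isClosed_iInter fun i => isClosed_le continuous_const (hφ i)))
  have heq : {ω | ∃ y, (F ω, y) ∈ A ∧ ∀ i, 0 < φ i (F ω, y)} =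
      ⋃ n : ℕ, F ⁻¹' (Prod.fst '' (A ∩ ⋂ i, {z | 1 / ((n : ℝ) + 1) ≤ φ i z})) := by
    ext ω
    simp only [Set.mem_ofPred_eq, Set.mem_iUnion, Set.mem_preimage, Set.mem_image,
      Set.mem_inter_iff,
      Set.mem_iInter]
    constructor
    · rintro ⟨y, hy, hpos⟩
      obtain ⟨n, hn⟩ := (eventually_all.2 fun i =>
        (tendsto_one_div_add_atTop_nhds_zero_nat (𝕜 := ℝ)).eventually_le_const (hpos i)).exists
      exact ⟨n, (F ω, y), ⟨hy, hn⟩, rfl⟩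
    · rintro ⟨n, ⟨_, y⟩, ⟨hy, hn⟩, rfl⟩
      exact ⟨y, hy, fun i => lt_of_lt_of_le Nat.one_div_pos_of_nat (hn i)⟩
  rw [heq]
  refine MeasurableSet.iUnion fun n => ?_
  rw [← compl_compl (Prod.fst '' _), Set.preimage_compl]
  exact (measurableSet_preimage_of_isOpen hF (hcl n).isOpen_compl).compl

theorem measurable_enat_of_measurableSet_le {f : Ω → ℕ∞}
    (h : ∀ k : ℕ, MeasurableSet {ω | (k : ℕ∞) ≤ f ω}) : Measurable f := by
  refine ENat.measurable_iff.2 fun n => ?_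
  have : f ⁻¹' {(n : ℕ∞)} = {ω | (n : ℕ∞) ≤ f ω} \ {ω | ((n + 1 : ℕ) : ℕ∞) ≤ f ω} := by
    ext ω
    simp only [Set.mem_preimage, Set.mem_singleton_iff, Set.mem_sdiff, Set.mem_ofPred_eq]
    cases f ω with
    | top => simp
    | coe m => norm_cast; omega
  rw [this]
  exact (h n).diff (h (n + 1))

variable [ConnectedSpace M] [LocallyPathConnectedSpace M]

/-- The merge level is continuous in the points and 1-Lipschitz in the function, hence jointly
continuous. -/
theorem continuous_uncurry_mergeLevel :
    Continuous fun z : C(M, ℝ) × M × M => mergeLevel z.1 z.2.1 z.2.2 :=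
  continuous_prod_of_continuous_lipschitzWith _ 1 continuous_mergeLevel fun z =>
    LipschitzWith.of_le_add fun f g => mergeLevel_le_add (fun p => by
      have := (abs_le.1 (ContinuousMap.dist_apply_le_dist (f := f) (g := g) p)).2
      linarith) z.1 z.2

theorem measurable_barCount {F : Ω → C(M, ℝ)} (hF : ∀ p, Measurable fun ω => F ω p) {ε : ℝ}
    (hε : 0 ≤ ε) : Measurable fun ω => barCount ε (F ω) := by
  refine measurable_enat_of_measurableSet_le fun k => ?_
  simp only [le_barCount_iff _ hε]
  have hA : IsClosed (⋂ i, {z : C(M, ℝ) × M × (Fin k → M) | z.1 z.2.1 ≤ z.1 (z.2.2 i) - ε}) :=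
    isClosed_iInter fun i => isClosed_le (by fun_prop) (by fun_prop)
  have hφ : ∀ ij : {ij : Fin k × Fin k // ij.1 ≠ ij.2},
      Continuous fun z : C(M, ℝ) × M × (Fin k → M) =>
        z.1 (z.2.2 ij.1.1) - ε - mergeLevel z.1 (z.2.2 ij.1.1) (z.2.2 ij.1.2) := fun ij => by
    refine Continuous.sub (by fun_prop) (continuous_uncurry_mergeLevel.comp
      (g := fun z : C(M, ℝ) × M × M => mergeLevel z.1 z.2.1 z.2.2)
      (f := fun z : C(M, ℝ) × M × (Fin k → M) => (z.1, z.2.2 ij.1.1, z.2.2 ij.1.2))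
      (by fun_prop))
  convert measurableSet_exists_mem_and_pos hF hA hφ using 3 with ω
  simp

theorem measurable_levelCount {F : Ω → C(M, ℝ)} (hF : ∀ p, Measurable fun ω => F ω p) (x : ℝ)
    {ε : ℝ} (hε : 0 ≤ ε) : Measurable fun ω => levelCount x ε (F ω) := by
  refine measurable_enat_of_measurableSet_le fun k => ?_
  simp only [le_levelCount_iff _ x hε]
  have hA : IsClosed (⋂ i, {z : C(M, ℝ) × M × (Fin k → M) |
      z.1 z.2.1 ≤ x ∧ x + ε ≤ z.1 (z.2.2 i)}) :=
    isClosed_iInter fun i => IsClosed.and (isClosed_le (by fun_prop) (by fun_prop))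
      (isClosed_le (by fun_prop) (by fun_prop))
  have hφ : ∀ ij : {ij : Fin k × Fin k // ij.1 ≠ ij.2},
      Continuous fun z : C(M, ℝ) × M × (Fin k → M) =>
        x - mergeLevel z.1 (z.2.2 ij.1.1) (z.2.2 ij.1.2) := fun ij => by
    refine Continuous.sub (by fun_prop) (continuous_uncurry_mergeLevel.comp
      (g := fun z : C(M, ℝ) × M × M => mergeLevel z.1 z.2.1 z.2.2)
      (f := fun z : C(M, ℝ) × M × (Fin k → M) => (z.1, z.2.2 ij.1.1, z.2.2 ij.1.2))
      (by fun_prop))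
  convert measurableSet_exists_mem_and_pos hF hA hφ using 3 with ω
  simp

omit [CompactSpace M] [ConnectedSpace M] [LocallyPathConnectedSpace M] in
/-- A functional of continuous functions that is measurable along measurable families is almost
everywhere measurable along almost surely continuous processes. -/
theorem aemeasurable_of_ae_continuous {P : Measure Ω} {X : M → Ω → ℝ}
    (hX : ∀ p, Measurable (X p)) (hXc : ∀ᵐ ω ∂P, Continuous fun p => X p ω)
    {Φ : (M → ℝ) → ℕ∞} (hΦ : ∀ F : Ω → C(M, ℝ), (∀ p, Measurable fun ω => F ω p) →
      Measurable fun ω => Φ (F ω)) : AEMeasurable (fun ω => Φ fun p => X p ω) P := by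
  classical
  -- Off a measurable full-measure set of continuous paths, the process is replaced by the zero
  -- function.
  obtain ⟨G, hG, hGm, hGc⟩ := hXc.exists_measurable_mem
  let F : Ω → C(M, ℝ) := fun ω => if h : ω ∈ G then ⟨fun p => X p ω, hGc ω h⟩ else 0
  have hF : ∀ ω p, F ω p = if ω ∈ G then X p ω else 0 := fun ω p => by
    by_cases h : ω ∈ G <;> simp [F, h]
  refine ⟨fun ω => Φ (F ω), hΦ F fun p => ?_, ?_⟩
  · simp only [hF]
    exact Measurable.ite hGm (hX p) measurable_const
  · filter_upwards [hG] with ω hω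
    congr 1
    ext p
    rw [hF, if_pos hω]

end Measurability

/-! ### From a squeeze of counts to convergence in `L¹`. -/

section Convergence

variable {Ω : Type*} [MeasurableSpace Ω] {P : Measure Ω}

theorem enorm_toNat_sub_toNat_le {a b l u : ℕ∞} (ha : a ≠ ⊤) (hb : b ≠ ⊤) (hla : l ≤ a)
    (hlb : l ≤ b) (hau : a ≤ u) (hbu : b ≤ u) :
    ‖(a.toNat : ℝ) - (b.toNat : ℝ)‖ₑ ≤ (u : ℝ≥0∞) - (l : ℝ≥0∞) := by
  lift l to ℕ using ne_top_of_le_ne_top ha hla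
  lift a to ℕ using ha
  lift b to ℕ using hb
  cases u with
  | top => simp
  | coe u =>
    norm_cast at hla hlb hau hbu
    rw [Real.enorm_eq_ofReal_abs, ENat.toENNReal_coe, ENat.toENNReal_coe,
      ← ENNReal.ofReal_natCast u, ← ENNReal.ofReal_natCast l,
      ← ENNReal.ofReal_sub _ (Nat.cast_nonneg l), ENat.toNat_natCast, ENat.toNat_natCast]
    refine ENNReal.ofReal_le_ofReal (abs_le.2 ?_)
    have h1 : (l : ℝ) ≤ a := by exact_mod_cast hla
    have h2 : (l : ℝ) ≤ b := by exact_mod_cast hlb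
    have h3 : (a : ℝ) ≤ u := by exact_mod_cast hau
    have h4 : (b : ℝ) ≤ u := by exact_mod_cast hbu
    constructor <;> linarith

theorem aestronglyMeasurable_toNat {N : Ω → ℕ∞} (hN : AEMeasurable N P) :
    AEStronglyMeasurable (fun ω => ((N ω).toNat : ℝ)) P :=
  ((measurable_from_top (f := fun n : ℕ∞ => (n.toNat : ℝ))).comp_aemeasurable
    hN).aestronglyMeasurable

theorem integrable_toNat {N : Ω → ℕ∞} (hN : AEMeasurable N P)
    (hfin : ∫⁻ ω, (N ω : ℝ≥0∞) ∂P ≠ ∞) : Integrable (fun ω => ((N ω).toNat : ℝ)) P := by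
  refine ⟨aestronglyMeasurable_toNat hN, lt_of_le_of_lt (lintegral_mono fun ω => ?_)
    hfin.lt_top⟩
  change ‖((N ω).toNat : ℝ)‖ₑ ≤ _
  cases N ω with
  | top => simp
  | coe n => simp

/-- Counts squeezed, together with their limit, between two families of counts whose means
converge to the mean of the limit converge in `L¹`. -/
theorem tendstoL1_and_lintegral_le {N : Ω → ℕ∞} {N' : ℕ → Ω → ℕ∞} {L U : ℝ → Ω → ℕ∞}
    {δ : ℕ → ℝ≥0∞} (hδ : Tendsto δ atTop (𝓝 0)) {ε : ℝ} (hε : 0 < ε)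
    (hN : AEMeasurable N P) (hN' : ∀ n, AEMeasurable (N' n) P)
    (hL : ∀ η, 0 ≤ η → AEMeasurable (L η) P)
    (hNtop : ∀ᵐ ω ∂P, N ω ≠ ⊤) (hN'top : ∀ n, ∀ᵐ ω ∂P, N' n ω ≠ ⊤)
    (hsq : ∀ n, 2 * δ n ≤ ENNReal.ofReal ε → ∀ᵐ ω ∂P,
      (L (2 * (δ n).toReal) ω ≤ N ω ∧ L (2 * (δ n).toReal) ω ≤ N' n ω) ∧
        N ω ≤ U (2 * (δ n).toReal) ω ∧ N' n ω ≤ U (2 * (δ n).toReal) ω)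
    (hfin : ∫⁻ ω, (N ω : ℝ≥0∞) ∂P ≠ ∞)
    (hLlim : Tendsto (fun η => ∫⁻ ω, (L η ω : ℝ≥0∞) ∂P) (𝓝 0) (𝓝 (∫⁻ ω, (N ω : ℝ≥0∞) ∂P)))
    (hUlim : Tendsto (fun η => ∫⁻ ω, (U η ω : ℝ≥0∞) ∂P) (𝓝 0) (𝓝 (∫⁻ ω, (N ω : ℝ≥0∞) ∂P))) :
    TendstoL1 P N' N ∧ ∀ n, 2 * δ n ≤ ENNReal.ofReal ε →
      ∫⁻ ω, ‖((N ω).toNat : ℝ) - ((N' n ω).toNat : ℝ)‖ₑ ∂P ≤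
        ∫⁻ ω, ((U (2 * (δ n).toReal) ω : ℝ≥0∞) - (L (2 * (δ n).toReal) ω : ℝ≥0∞)) ∂P := by
  have hbound : ∀ n, 2 * δ n ≤ ENNReal.ofReal ε →
      ∫⁻ ω, ‖((N ω).toNat : ℝ) - ((N' n ω).toNat : ℝ)‖ₑ ∂P ≤
        ∫⁻ ω, ((U (2 * (δ n).toReal) ω : ℝ≥0∞) - (L (2 * (δ n).toReal) ω : ℝ≥0∞)) ∂P := by
    intro n hn
    refine lintegral_mono_ae ?_
    filter_upwards [hsq n hn, hNtop, hN'top n] with ω h h1 h2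
    exact enorm_toNat_sub_toNat_le h1 h2 h.1.1 h.1.2 h.2.1 h.2.2
  have hη : Tendsto (fun n => 2 * (δ n).toReal) atTop (𝓝 0) := by
    simpa using ((ENNReal.tendsto_toReal ENNReal.zero_ne_top).comp hδ).const_mul 2
  have hsmall : ∀ᶠ n in atTop, 2 * δ n ≤ ENNReal.ofReal ε := by
    have : Tendsto (fun n => 2 * δ n) atTop (𝓝 0) := by
      simpa using ENNReal.Tendsto.const_mul hδ (Or.inr ENNReal.ofNat_ne_top)
    exact this.eventually_le_const (ENNReal.ofReal_pos.2 hε)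
  refine ⟨⟨hN'top, hNtop, fun n => aestronglyMeasurable_toNat (hN' n), integrable_toNat hN hfin,
    ?_, ?_⟩, hbound⟩
  -- The mean of the upper count tends to a finite limit, so it is eventually finite and dominates
  -- that of `N' n`.
  · filter_upwards [hsmall, (hUlim.comp hη).eventually_lt_const hfin.lt_top] with n hn hUn
    refine integrable_toNat (hN' n) (ne_top_of_le_ne_top hUn.ne (lintegral_mono_ae ?_))
    filter_upwards [hsq n hn] with ω h
    exact ENat.toENNReal_le.2 h.2.2
  · have hlim := ENNReal.Tendsto.sub (hUlim.comp hη) (hLlim.comp hη) (Or.inl hfin)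
    rw [tsub_self] at hlim
    refine tendsto_of_tendsto_of_tendsto_of_le_of_le' tendsto_const_nhds hlim
      (Eventually.of_forall fun _ => zero_le) ?_
    filter_upwards [hsmall] with n hn
    rw [eLpNorm_one_eq_lintegral_enorm]
    simp only [enorm_sub_rev ((N' n _).toNat : ℝ)]
    refine (hbound n hn).trans (le_of_eq ?_)
    -- The modulus becomes a difference of means. Only the subtracted count `L` has to be measurable
    -- and of finite mean.
    refine lintegral_sub' ?_ (ne_top_of_le_ne_top hfin (lintegral_mono_ae ?_)) ?_
    · exact measurable_from_top.comp_aemeasurable (hL _ (by positivity))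
    · filter_upwards [hsq n hn] with ω h
      exact ENat.toENNReal_le.2 h.1.1
    · filter_upwards [hsq n hn] with ω h
      exact ENat.toENNReal_le.2 (h.1.1.trans h.2.1)

end Convergence

/-! ### Pathwise squeeze, and the theorem. -/

section Processes

variable {M : Type*} {Ω : Type*} [MeasurableSpace Ω] {P : Measure Ω}

theorem ae_abs_sub_le_of_supDist_ne_top {X Y : M → Ω → ℝ} (h : supDist P X Y ≠ ∞) :
    ∀ᵐ ω ∂P, ∀ p, |X p ω - Y p ω| ≤ (supDist P X Y).toReal := by
  filter_upwards [ENNReal.ae_le_essSup fun ω => ⨆ p : M, ‖X p ω - Y p ω‖ₑ] with ω hω p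
  have h1 : ‖X p ω - Y p ω‖ₑ ≤ supDist P X Y :=
    (le_iSup (fun p => ‖X p ω - Y p ω‖ₑ) p).trans hω
  rw [Real.enorm_eq_ofReal_abs] at h1
  exact (ENNReal.ofReal_le_iff_le_toReal h).1 h1

variable [MetricSpace M] [CompactSpace M] [ConnectedSpace M] [LocallyPathConnectedSpace M]

/-- Stability applied to the pairs `(f, f)`, `(f, g)` and `(g, f)`; the pair `(f, f)` gives the
needed monotonicity in `ε`. -/
theorem barCount_squeeze {f g : M → ℝ} (hf : Continuous f) (hg : Continuous g) {δ ε : ℝ}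
    (hfg : ∀ p, |f p - g p| ≤ δ) (hδε : 2 * δ ≤ ε) :
    (barCount (ε + 2 * δ) f ≤ barCount ε f ∧ barCount (ε + 2 * δ) f ≤ barCount ε g) ∧
      barCount ε f ≤ barCount (ε - 2 * δ) f ∧ barCount ε g ≤ barCount (ε - 2 * δ) f := by
  have hδ : 0 ≤ δ := (abs_nonneg _).trans (hfg (Classical.arbitrary M))
  have hff : ∀ p, |f p - f p| ≤ δ := fun p => by simpa using hδ
  have hgf : ∀ p, |g p - f p| ≤ δ := fun p => by rw [abs_sub_comm]; exact hfg p
  have h1 := barCount_add_le (f := ⟨f, hf⟩) (g := ⟨f, hf⟩) hff (ε := ε) (by linarith)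
  have h2 := barCount_add_le (f := ⟨f, hf⟩) (g := ⟨g, hg⟩) hfg (ε := ε) (by linarith)
  have h3 := barCount_add_le (f := ⟨f, hf⟩) (g := ⟨f, hf⟩) hff (sub_nonneg.2 hδε)
  have h4 := barCount_add_le (f := ⟨g, hg⟩) (g := ⟨f, hf⟩) hgf (sub_nonneg.2 hδε)
  rw [sub_add_cancel] at h3 h4
  exact ⟨⟨h1, h2⟩, h3, h4⟩

theorem levelCount_squeeze {f g : M → ℝ} (hf : Continuous f) (hg : Continuous g) {δ ε : ℝ}
    (hfg : ∀ p, |f p - g p| ≤ δ) (x : ℝ) (hδε : 2 * δ ≤ ε) :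
    (levelCount (x - 2 * δ / 2) (ε + 2 * δ) f ≤ levelCount x ε f ∧
      levelCount (x - 2 * δ / 2) (ε + 2 * δ) f ≤ levelCount x ε g) ∧
      levelCount x ε f ≤ levelCount (x + 2 * δ / 2) (ε - 2 * δ) f ∧
      levelCount x ε g ≤ levelCount (x + 2 * δ / 2) (ε - 2 * δ) f := by
  have hδ : 0 ≤ δ := (abs_nonneg _).trans (hfg (Classical.arbitrary M))
  have hff : ∀ p, |f p - f p| ≤ δ := fun p => by simpa using hδ
  have hgf : ∀ p, |g p - f p| ≤ δ := fun p => by rw [abs_sub_comm]; exact hfg p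
  have h1 := levelCount_add_le (f := ⟨f, hf⟩) (g := ⟨f, hf⟩) hff x (ε := ε) (by linarith)
  have h2 := levelCount_add_le (f := ⟨f, hf⟩) (g := ⟨g, hg⟩) hfg x (ε := ε) (by linarith)
  -- Starting from the shortened window `[x+δ, x+ε-δ]`, stability enlarges it back to `[x, x+ε]`.
  have h3 := levelCount_add_le (f := ⟨f, hf⟩) (g := ⟨f, hf⟩) hff (x + δ) (sub_nonneg.2 hδε)
  have h4 := levelCount_add_le (f := ⟨g, hg⟩) (g := ⟨f, hf⟩) hgf (x + δ) (sub_nonneg.2 hδε)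
  rw [sub_add_cancel, add_sub_cancel_right] at h3 h4
  rw [mul_div_cancel_left₀ δ two_ne_zero]
  exact ⟨⟨h1, h2⟩, h3, h4⟩

end Processes

end HZeroTree

theorem mainTheorem5 {M : Type*} [MetricSpace M] [CompactSpace M] [ConnectedSpace M]
    [LocallyPathConnectedSpace M] {Ω : Type*} [MeasurableSpace Ω] (P : Measure Ω)
    [IsProbabilityMeasure P] (X : M → Ω → ℝ) (Y : ℕ → M → Ω → ℝ)
    (hX : ∀ p, Measurable (X p)) (hXc : ∀ᵐ ω ∂P, Continuous fun p => X p ω)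
    (hY : ∀ n p, Measurable (Y n p)) (hYc : ∀ n, ∀ᵐ ω ∂P, Continuous fun p => Y n p ω)
    (δ : ℕ → ℝ≥0∞) (hδ : ∀ n, δ n = HZeroTree.supDist P X (Y n))
    (hδ0 : Tendsto δ atTop (𝓝 0)) :
    (((∀ ε : ℝ, 0 < ε → HZeroTree.meanBarCount P X ε ≠ ∞) ∧
        ContinuousOn (HZeroTree.meanBarCount P X) (Set.Ioi 0)) →
      ∀ ε : ℝ, 0 < ε →
        HZeroTree.TendstoL1 P (fun n ω => HZeroTree.barCount ε fun p => Y n p ω)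
          (fun ω => HZeroTree.barCount ε fun p => X p ω) ∧
        ∀ n, 2 * δ n ≤ ENNReal.ofReal ε →
          ∫⁻ ω, ‖((HZeroTree.barCount ε fun p => X p ω).toNat : ℝ) -
              ((HZeroTree.barCount ε fun p => Y n p ω).toNat : ℝ)‖ₑ ∂P ≤
            HZeroTree.barModulus P X ε (2 * (δ n).toReal)) ∧
    (∀ x : ℝ,
      ((∀ ε : ℝ, 0 < ε → HZeroTree.meanLevelCount P X x ε ≠ ∞) ∧
        (∀ ε : ℝ, 0 < ε →
          ContinuousAt (fun z : ℝ × ℝ => HZeroTree.meanLevelCount P X z.1 z.2) (x, ε))) →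
      ∀ ε : ℝ, 0 < ε →
        HZeroTree.TendstoL1 P (fun n ω => HZeroTree.levelCount x ε fun p => Y n p ω)
          (fun ω => HZeroTree.levelCount x ε fun p => X p ω) ∧
        ∀ n, 2 * δ n ≤ ENNReal.ofReal ε →
          ∫⁻ ω, ‖((HZeroTree.levelCount x ε fun p => X p ω).toNat : ℝ) -
              ((HZeroTree.levelCount x ε fun p => Y n p ω).toNat : ℝ)‖ₑ ∂P ≤
            HZeroTree.levelModulus P X x ε (2 * (δ n).toReal)) := by
  have hsup : ∀ (n : ℕ) (ε : ℝ), 0 < ε → 2 * δ n ≤ ENNReal.ofReal ε →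
      2 * (δ n).toReal ≤ ε ∧ ∀ᵐ ω ∂P, ∀ p, |X p ω - Y n p ω| ≤ (δ n).toReal := by
    intro n ε hε hn
    have h2 := ne_top_of_le_ne_top ENNReal.ofReal_ne_top hn
    -- Needed because `toReal` sends `∞` to `0`, which would wrongly claim that the processes
    -- coincide.
    have hfin : δ n ≠ ∞ := fun h => h2 (by simp [h])
    refine ⟨?_, ?_⟩
    · simpa [hε.le] using ENNReal.toReal_mono ENNReal.ofReal_ne_top hn
    · rw [hδ n] at hfin ⊢
      exact HZeroTree.ae_abs_sub_le_of_supDist_ne_top hfin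
  refine ⟨fun ⟨hfin, hcont⟩ ε hε => ?_, fun x ⟨hfin, hcont⟩ ε hε => ?_⟩
  · have hmeas : ∀ {Z : M → Ω → ℝ}, (∀ p, Measurable (Z p)) →
        (∀ᵐ ω ∂P, Continuous fun p => Z p ω) → ∀ {a : ℝ}, 0 ≤ a →
        AEMeasurable (fun ω => HZeroTree.barCount a fun p => Z p ω) P := fun hZ hZc _ ha =>
      HZeroTree.aemeasurable_of_ae_continuous hZ hZc fun _ hF => HZeroTree.measurable_barCount hF ha
    have hat := hcont.continuousAt (Ioi_mem_nhds hε)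
    refine HZeroTree.tendstoL1_and_lintegral_le
      (L := fun η ω => HZeroTree.barCount (ε + η) fun p => X p ω)
      (U := fun η ω => HZeroTree.barCount (ε - η) fun p => X p ω) hδ0 hε (hmeas hX hXc hε.le)
      (fun n => hmeas (hY n) (hYc n) hε.le) (fun η hη => hmeas hX hXc (by positivity))
      (hXc.mono fun ω h => HZeroTree.barCount_ne_top ⟨_, h⟩ hε)
      (fun n => (hYc n).mono fun ω h => HZeroTree.barCount_ne_top ⟨_, h⟩ hε)
      (fun n hn => ?_) (hfin ε hε) ?_ ?_
    · obtain ⟨h1, h2⟩ := hsup n ε hε hn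
      filter_upwards [hXc, hYc n, h2] with ω hx hy hxy
      exact HZeroTree.barCount_squeeze hx hy hxy h1
    · refine Tendsto.comp (g := HZeroTree.meanBarCount P X) (f := fun η => ε + η) hat ?_
      exact Continuous.tendsto' (by fun_prop) _ _ (add_zero ε)
    · refine Tendsto.comp (g := HZeroTree.meanBarCount P X) (f := fun η => ε - η) hat ?_
      exact Continuous.tendsto' (by fun_prop) _ _ (sub_zero ε)
  · have hmeas : ∀ {Z : M → Ω → ℝ}, (∀ p, Measurable (Z p)) →
        (∀ᵐ ω ∂P, Continuous fun p => Z p ω) → ∀ (y : ℝ) {a : ℝ}, 0 ≤ a →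
        AEMeasurable (fun ω => HZeroTree.levelCount y a fun p => Z p ω) P := fun hZ hZc y _ ha =>
      HZeroTree.aemeasurable_of_ae_continuous hZ hZc fun _ hF =>
        HZeroTree.measurable_levelCount hF y ha
    have hat := hcont ε hε
    refine HZeroTree.tendstoL1_and_lintegral_le
      (L := fun η ω => HZeroTree.levelCount (x - η / 2) (ε + η) fun p => X p ω)
      (U := fun η ω => HZeroTree.levelCount (x + η / 2) (ε - η) fun p => X p ω) hδ0 hε
      (hmeas hX hXc x hε.le) (fun n => hmeas (hY n) (hYc n) x hε.le)
      (fun η hη => hmeas hX hXc _ (by positivity))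
      (hXc.mono fun ω h => HZeroTree.levelCount_ne_top ⟨_, h⟩ x hε)
      (fun n => (hYc n).mono fun ω h => HZeroTree.levelCount_ne_top ⟨_, h⟩ x hε)
      (fun n hn => ?_) (hfin ε hε) ?_ ?_
    · obtain ⟨h1, h2⟩ := hsup n ε hε hn
      filter_upwards [hXc, hYc n, h2] with ω hx hy hxy
      exact HZeroTree.levelCount_squeeze hx hy hxy x h1
    -- Both window ends move with `η`, hence the joint continuity at `(x, ε)`, used along a line
    -- through that point.
    · refine Tendsto.comp (g := fun z : ℝ × ℝ => HZeroTree.meanLevelCount P X z.1 z.2)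
        (f := fun η => (x - η / 2, ε + η)) hat ?_
      exact Continuous.tendsto' (by fun_prop) _ _ (by simp)
    · refine Tendsto.comp (g := fun z : ℝ × ℝ => HZeroTree.meanLevelCount P X z.1 z.2)
        (f := fun η => (x + η / 2, ε - η)) hat ?_
      exact Continuous.tendsto' (by fun_prop) _ _ (by simp)
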